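/- Let $\mu,\nu>0$ with $\mu+\nu=1$ and let $N\ge 0$ be an integer. Let $Y_1,\dots,Y_N$ be independent right-continuous Markov jump processes on $\{0,1\}$, each with $Q$-matrix $$\begin{pmatrix}-\nu&\nu\\ \mu&-\mu\end{pmatrix}$$ (so a particle jumps from $0$ to $1$ at rate $\nu$ and from $1$ to $0$ at rate $\mu$) and with arbitrary initial distributions, and let $E_N(t)=Y_1(t)+\cdots+Y_N(t)$, $t\ge 0$, be the Ehrenfest process with $N$ particles. For $0\le x\le N$ let $T_x=\inf\{t>0:E_N(t)=x\}\in[0,\infty]$ (with $\inf\emptyset=\infty$ and $e^{-\infty}=0$), and let $\mathbb E_z$ denote expectation conditionally on $\{E_N(0)=z\}$, whenever this event has positive probability. For $\alpha>0$ put $$B_x(\alpha)=\int_0^1(1-u)^x\Bigl(1+\frac{\nu}{\mu}u\Bigr)^{N-x}u^{\alpha-1}\,du,\qquad D_x(\alpha)=\int_0^1(1-u)^{N-x}\Bigl(1+\frac{\mu}{\nu}u\Bigr)^{x}u^{\alpha-1}\,du .$$ Then for all $\alpha>0$ and all integers $0\le x\le y\le N$, $$\mathbb E_y\bigl(e^{-\alpha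 T_x}\bigr)=\frac{B_y(\alpha)}{B_x(\alpha)}\qquad\text{and}\qquad \mathbb E_x\bigl(e^{-\alpha T_y}\bigr)=\frac{D_x(\alpha)}{D_y(\alpha)} .$$ -/

import Mathlib

open MeasureTheory ProbabilityTheory
open scoped NNReal ENNReal

noncomputable section

namespace Ehrenfest

/-- `X` is a (time-homogeneous, right-continuous) Markov jump process on the finite state space `S`
with `Q`-matrix `Q`, for the probability measure `P` and with an arbitrary initial distribution:
the state is `b` at a later time `t'`, given the states at finitely many times up to `t` with `a` the
state at time `t`, with probability `exp ((t' - t) Q) a b`. -/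
structure IsMarkovJumpProcess {Ω S : Type*} [MeasurableSpace Ω] [Fintype S] [DecidableEq S]
    [TopologicalSpace S] [DiscreteTopology S] [MeasurableSpace S] [MeasurableSingletonClass S]
    (Q : Matrix S S ℝ) (P : Measure Ω) (X : ℝ≥0 → Ω → S) : Prop where
  measurable : ∀ t, Measurable (X t)
  rightContinuous : ∀ ω t, ContinuousWithinAt (fun s => X s ω) (Set.Ici t) t
  markov : ∀ (n : ℕ) (t : Fin (n + 2) → ℝ≥0) (s : Fin (n + 2) → S), StrictMono t →
    P.real {ω | ∀ i, X (t i) ω = s i} =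
      P.real {ω | ∀ i : Fin (n + 1), X (t i.castSucc) ω = s i.castSucc} *
        NormedSpace.exp
          (((t (Fin.last (n + 1)) : ℝ) - (t (Fin.last n).castSucc : ℝ)) • Q)
          (s (Fin.last n).castSucc) (s (Fin.last (n + 1)))

/-- The `Q`-matrix of a single particle: it moves from box `0` to box `1` at rate `ν`
and from box `1` to box `0` at rate `μ`. -/
def particleQ (μ ν : ℝ) : Matrix (Fin 2) (Fin 2) ℝ :=
  !![-ν, ν; μ, -μ]

/-- `E` is an Ehrenfest process with `N` particles and rates `μ`, `ν`, for the probability measure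
`P`: the number of particles in box `1`, when the particles move independently of each other
as Markov jump processes with `Q`-matrix `particleQ μ ν`. The initial position
of each particle is arbitrary (deterministic or random). -/
def IsEhrenfestProcess {Ω : Type*} [MeasurableSpace Ω] (μ ν : ℝ) (N : ℕ) (P : Measure Ω)
    (E : ℝ≥0 → Ω → ℕ) : Prop :=
  ∃ Y : Fin N → ℝ≥0 → Ω → Fin 2,
    (∀ i, IsMarkovJumpProcess (particleQ μ ν) P (Y i)) ∧
    iIndepFun (fun i ω t => Y i t ω) P ∧
    ∀ t ω, E t ω = ∑ i, (Y i t ω : ℕ)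

/-- The hitting time `inf {t > 0 : E t = x}` in `[0, ∞]`, with `inf ∅ = ∞`. -/
def hitTime {Ω : Type*} (E : ℝ≥0 → Ω → ℕ) (x : ℕ) (ω : Ω) : ℝ≥0∞ :=
  ⨅ (t : ℝ≥0) (_ : 0 < t ∧ E t ω = x), (t : ℝ≥0∞)

/-- `exp (-α T)` for `T` in `[0, ∞]`, with the value `0` at `T = ∞`. -/
def expNeg (α : ℝ) (T : ℝ≥0∞) : ℝ :=
  if T = ∞ then 0 else Real.exp (-(α * T.toReal))

/-- `𝔼_z (exp (-α T_x))`: the Laplace transform at `α` of the hitting time of `x`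
by `E` started at `z`, that is, under the conditional probability given `E 0 = z`. -/
def laplaceHit {Ω : Type*} [MeasurableSpace Ω] (P : Measure Ω) (E : ℝ≥0 → Ω → ℕ)
    (α : ℝ) (z x : ℕ) : ℝ :=
  ∫ ω, expNeg α (hitTime E x ω) ∂(cond P {ω | E 0 ω = z})

/-- `B_x(α) = ∫₀¹ (1-u)^x (1 + (ν/μ) u)^(N-x) u^(α-1) du`, for `x ≤ N`. -/
def B (μ ν : ℝ) (N : ℕ) (α : ℝ) (x : ℕ) : ℝ :=
  ∫ u in (0 : ℝ)..1, (1 - u) ^ x * (1 + ν / μ * u) ^ (N - x) * u ^ (α - 1)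

/-- `D_x(α) = ∫₀¹ (1-u)^(N-x) (1 + (μ/ν) u)^x u^(α-1) du`, for `x ≤ N`. -/
def D (μ ν : ℝ) (N : ℕ) (α : ℝ) (x : ℕ) : ℝ :=
  ∫ u in (0 : ℝ)..1, (1 - u) ^ (N - x) * (1 + μ / ν * u) ^ x * u ^ (α - 1)

end Ehrenfest

end

/-!
Both formulas come from optional stopping. Let `f` be a function of the number of particles in box
`1` which satisfies the eigenvalue equation `A f = α f` for the Ehrenfest generator
`(A f) k = k μ (f (k - 1) - f k) + (N - k) ν (f (k + 1) - f k)` outside a set `H` of states. Then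
`exp (-α t) f (E t)` stopped at the entrance to `H` is a martingale, so the mean of
`exp (-α σ) f (E σ)` is `f z` for the process started at `z ∉ H`, where `σ` is the entrance time.
Integration by parts shows that `B` satisfies the equation at every state but `0`
(`B_generator`), so that `H = {k | k ≤ x}` may be taken for it; exchanging the boxes turns this
into the statement that `D` satisfies it at every state but `N` (`D_generator`), which suits
`H = {k | y ≤ k}`.

Optional stopping is proved without any strong Markov property (`integral_entrance`). On a grid of
mesh `h` the configuration of all particles is a Markov chain on a finite state space
(`isChain_grid`). As the equation holds off `H`, one step changes the mean of the discounted
function by `o(h)` only (`tendsto_defect`), and as the discount factors of all steps add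
up to order `1 / h`, the total error vanishes with `h`
(`IsChain.abs_integral_stopped_sub_le`). Paths are right-continuous in a discrete space, so the
values at the entrance along the grids converge (`tendsto_stopped`), boundedly.

The process enters `H` at the target state almost surely. This too follows from optional stopping:
the equation off `H` does not see the values of `f` at the states of `H` other than the target,
whereas the mean at the entrance would if these states were entered first with positive probability
(`laplaceHit_eq_div`).
-/

namespace Ehrenfest

open Filter Topology

/-! ### The equation satisfied by `B` and `D` -/

lemma intervalIntegrable_mul_rpow {α : ℝ} (hα : 0 < α) {g : ℝ → ℝ} (hg : Continuous g) :
    IntervalIntegrable (fun u => g u * u ^ (α - 1)) volume 0 1 := by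
  have h := intervalIntegral.intervalIntegrable_rpow' (a := 0) (b := 1)
    (r := α - 1) (by linarith)
  exact h.continuousOn_mul hg.continuousOn

lemma B_pos {μ ν : ℝ} (hμ : 0 < μ) (hν : 0 < ν) (N : ℕ) {α : ℝ} (hα : 0 < α) (k : ℕ) :
    0 < B μ ν N α k := by
  refine intervalIntegral.intervalIntegral_pos_of_pos_on
    (intervalIntegrable_mul_rpow hα (by fun_prop)) (fun u hu => ?_) one_pos
  obtain ⟨h0, h1⟩ := hu
  have : 0 < 1 - u := by linarith
  positivity

/-- Integration by parts: the boundary term `u ^ α * g u` vanishes at `0` since `0 < α`, and at `1`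
by assumption. -/
lemma integral_deriv_mul_rpow {α : ℝ} (hα : 0 < α) {g g' : ℝ → ℝ}
    (hg : ∀ u, HasDerivAt g (g' u) u) (hg' : Continuous g') (h1 : g 1 = 0) :
    ∫ u in (0 : ℝ)..1, (-u * g' u) * u ^ (α - 1) = α * ∫ u in (0 : ℝ)..1, g u * u ^ (α - 1) := by
  have hgc : Continuous g := continuous_iff_continuousAt.2 fun u => (hg u).continuousAt
  have key : ∫ u in (0 : ℝ)..1, ((u * g' u) * u ^ (α - 1) + α * (g u * u ^ (α - 1))) =
      1 ^ α * g 1 - 0 ^ α * g 0 := by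
    refine intervalIntegral.integral_eq_sub_of_hasDerivAt_of_le (f := fun u => u ^ α * g u)
      zero_le_one ?_ (fun u hu => ?_) ?_
    · exact ((Real.continuous_rpow_const hα.le).mul hgc).continuousOn
    · have h := (Real.hasDerivAt_rpow_const (p := α) (Or.inl hu.1.ne')).mul (hg u)
      refine HasDerivAt.congr_deriv h ?_
      have : u ^ α = u ^ (α - 1) * u := by
        rw [Real.rpow_sub_one hu.1.ne']
        field_simp [hu.1.ne']
      rw [this]
      ring
    · exact (intervalIntegrable_mul_rpow hα (by fun_prop)).add
        ((intervalIntegrable_mul_rpow hα hgc).const_mul α)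
  rw [intervalIntegral.integral_add (intervalIntegrable_mul_rpow hα (by fun_prop))
    ((intervalIntegrable_mul_rpow hα hgc).const_mul α), h1, Real.zero_rpow hα.ne',
    intervalIntegral.integral_const_mul] at key
  have : ∫ u in (0 : ℝ)..1, (-u * g' u) * u ^ (α - 1) =
      - ∫ u in (0 : ℝ)..1, (u * g' u) * u ^ (α - 1) := by
    rw [← intervalIntegral.integral_neg]
    congr 1
    ext u
    ring
  linarith

/-- `B` solves the eigenvalue equation of the Ehrenfest generator at every state but `0`. -/
lemma B_generator {μ ν : ℝ} (hμ : 0 < μ) (hμν : ν + μ = 1) (N : ℕ) {α : ℝ}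
    (hα : 0 < α) {k : ℕ} (hk : k ≠ 0) (hkN : k ≤ N) :
    (k : ℝ) * μ * (B μ ν N α (k - 1) - B μ ν N α k) +
      ((N : ℝ) - k) * ν * (B μ ν N α (k + 1) - B μ ν N α k) = α * B μ ν N α k := by
  set r := ν / μ with hr
  have hr1 : μ * (1 + r) = 1 := by rw [hr]; field_simp; linarith
  have hr2 : ν * (1 + r) = r := by
    rw [hr]; field_simp; rw [add_comm μ, hμν, mul_one]
  obtain ⟨m, rfl⟩ := Nat.exists_eq_succ_of_ne_zero hk
  obtain ⟨n, rfl⟩ := Nat.exists_eq_add_of_le hkN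
  have hd : ∀ u : ℝ, HasDerivAt (fun u : ℝ => (1 - u) ^ (m + 1) * (1 + r * u) ^ n)
      (-((m + 1 : ℝ) * (1 - u) ^ m) * (1 + r * u) ^ n +
        (1 - u) ^ (m + 1) * (n * (1 + r * u) ^ (n - 1) * r)) u := fun u => by
    have h1 : HasDerivAt (fun u : ℝ => 1 - u) (-1) u := (hasDerivAt_id u).const_sub 1
    have h2 : HasDerivAt (fun u : ℝ => 1 + r * u) r u := by
      simpa using ((hasDerivAt_id u).const_mul r).const_add 1
    refine HasDerivAt.congr_deriv ((h1.fun_pow (m + 1)).mul (h2.fun_pow n)) ?_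
    rw [Nat.add_sub_cancel]
    push_cast
    ring
  have hB := integral_deriv_mul_rpow hα hd (by fun_prop) (by simp)
  have hB' : B μ ν (m + 1 + n) α (m + 1) =
      ∫ u in (0 : ℝ)..1, (1 - u) ^ (m + 1) * (1 + r * u) ^ n * u ^ (α - 1) := by
    rw [B, show m + 1 + n - (m + 1) = n by omega]
  change ((m + 1 : ℕ) : ℝ) * μ * (B μ ν (m + 1 + n) α m - B μ ν (m + 1 + n) α (m + 1)) +
      (((m + 1 + n : ℕ) : ℝ) - ((m + 1 : ℕ) : ℝ)) * ν *
        (B μ ν (m + 1 + n) α (m + 1 + 1) - B μ ν (m + 1 + n) α (m + 1)) = _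
  refine Eq.trans ?_ (hB.trans (by rw [← hB']))
  unfold B
  rw [← intervalIntegral.integral_sub (intervalIntegrable_mul_rpow hα (by fun_prop))
      (intervalIntegrable_mul_rpow hα (by fun_prop)),
    ← intervalIntegral.integral_sub (intervalIntegrable_mul_rpow hα (by fun_prop))
      (intervalIntegrable_mul_rpow hα (by fun_prop)),
    ← intervalIntegral.integral_const_mul, ← intervalIntegral.integral_const_mul,
    ← intervalIntegral.integral_add]
  · congr 1
    ext u
    have e1 : m + 1 + n - m = n + 1 := by omega
    have e2 : m + 1 + n - (m + 1) = n := by omega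
    have e3 : m + 1 + n - (m + 1 + 1) = n - 1 := by omega
    rw [e1, e2, e3, ← hr]
    push_cast
    rcases n with _ | n
    · simp only [Nat.cast_zero, pow_zero]
      linear_combination ((m + 1 : ℝ) * (1 - u) ^ m * u * u ^ (α - 1)) * hr1
    · simp only [Nat.add_sub_cancel]
      push_cast
      linear_combination ((m + 1 : ℝ) * (1 - u) ^ m * (1 + r * u) ^ (n + 1) * u *
        u ^ (α - 1)) * hr1 - ((n + 1 : ℝ) * (1 - u) ^ (m + 1) * (1 + r * u) ^ n * u *
        u ^ (α - 1)) * hr2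
  · exact ((intervalIntegrable_mul_rpow hα (by fun_prop)).sub
      (intervalIntegrable_mul_rpow hα (by fun_prop))).const_mul _
  · exact ((intervalIntegrable_mul_rpow hα (by fun_prop)).sub
      (intervalIntegrable_mul_rpow hα (by fun_prop))).const_mul _

/-- Exchanging the two boxes exchanges `B` and `D`. -/
lemma D_eq_B (μ ν : ℝ) {N : ℕ} (α : ℝ) {k : ℕ} (hk : k ≤ N) :
    D μ ν N α k = B ν μ N α (N - k) := by
  rw [D, B, Nat.sub_sub_self hk]

lemma D_generator {μ ν : ℝ} (hν : 0 < ν) (hμν : ν + μ = 1) (N : ℕ) {α : ℝ}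
    (hα : 0 < α) {k : ℕ} (hk : k < N) :
    (k : ℝ) * μ * (D μ ν N α (k - 1) - D μ ν N α k) +
      ((N : ℝ) - k) * ν * (D μ ν N α (k + 1) - D μ ν N α k) = α * D μ ν N α k := by
  have h := B_generator hν (by linarith : μ + ν = 1) N hα (k := N - k) (by omega) (by omega)
  rw [D_eq_B μ ν α hk.le, D_eq_B μ ν α (by omega : k - 1 ≤ N),
    D_eq_B μ ν α (by omega : k + 1 ≤ N), ← h, Nat.cast_sub hk.le, ← Nat.sub_sub N k 1]
  rcases Nat.eq_zero_or_pos k with rfl | h0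
  · simp
  · rw [show N - (k - 1) = N - k + 1 by omega]
    ring

/-! ### The generator of the configuration process -/

open scoped Matrix.Norms.Operator in
lemma hasDerivAt_exp_smul_apply {n : Type*} [Fintype n] [DecidableEq n] (Q : Matrix n n ℝ)
    (a b : n) : HasDerivAt (fun h : ℝ => NormedSpace.exp (h • Q) a b) (Q a b) 0 := by
  have h := hasDerivAt_exp_smul_const (𝕂 := ℝ) Q (0 : ℝ)
  rw [zero_smul, NormedSpace.exp_zero, one_mul] at h
  have hl : Continuous (Matrix.entryLinearMap ℝ ℝ a b) := LinearMap.continuous_of_finiteDimensional _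
  exact ((⟨Matrix.entryLinearMap ℝ ℝ a b, hl⟩ : Matrix n n ℝ →L[ℝ] ℝ).hasFDerivAt).comp_hasDerivAt
    (0 : ℝ) h

/-- The probability that the configuration of `N` particles, started at `s`, is `s'` after
time `h`. -/
noncomputable def transition (μ ν : ℝ) {N : ℕ} (h : ℝ) (s s' : Fin N → Fin 2) : ℝ :=
  ∏ i, NormedSpace.exp (h • particleQ μ ν) (s i) (s' i)

/-- The action of the transition matrix on a function of the configuration. -/
noncomputable def semigroup (μ ν : ℝ) {N : ℕ} (h : ℝ) (F : (Fin N → Fin 2) → ℝ)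
    (s : Fin N → Fin 2) : ℝ :=
  ∑ s', transition μ ν h s s' * F s'

/-- The number of particles in box `1`. -/
def count {N : ℕ} (s : Fin N → Fin 2) : ℕ := ∑ i, (s i : ℕ)

lemma semigroup_zero (μ ν : ℝ) {N : ℕ} (F : (Fin N → Fin 2) → ℝ) (s : Fin N → Fin 2) :
    semigroup μ ν 0 F s = F s := by
  simp only [semigroup, transition, zero_smul, NormedSpace.exp_zero, Matrix.one_apply]
  rw [Finset.sum_eq_single s]
  · simp
  · intro b _ hb
    obtain ⟨i, hi⟩ := Function.ne_iff.1 hb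
    rw [Finset.prod_eq_zero (Finset.mem_univ i) (if_neg (Ne.symm hi)), zero_mul]
  · simp

/-- The generator of the motion of the configuration: one particle moves at a time. -/
lemma hasDerivAt_semigroup (μ ν : ℝ) {N : ℕ} (F : (Fin N → Fin 2) → ℝ) (s : Fin N → Fin 2) :
    HasDerivAt (fun h => semigroup μ ν h F s)
      (∑ i, ∑ b, particleQ μ ν (s i) b * F (Function.update s i b)) 0 := by
  have h := HasDerivAt.fun_sum (u := Finset.univ) (x := (0 : ℝ)) fun (s' : Fin N → Fin 2) _ =>
    (HasDerivAt.fun_finsetProd (u := Finset.univ) fun i _ =>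
      hasDerivAt_exp_smul_apply (particleQ μ ν) (s i) (s' i)).mul_const (F s')
  refine HasDerivAt.congr_deriv h ?_
  simp only [zero_smul, NormedSpace.exp_zero, Matrix.one_apply, smul_eq_mul, Finset.sum_mul]
  rw [Finset.sum_comm]
  refine Finset.sum_congr rfl fun i _ => ?_
  symm
  refine Finset.sum_of_injOn (fun b => Function.update s i b)
    (fun a _ b _ hab => by simpa using congrFun hab i) (by simp) ?_ ?_
  · intro s' _ hs'
    obtain ⟨j, hji, hj⟩ : ∃ j, j ≠ i ∧ s j ≠ s' j := by
      by_contra! hcon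
      refine hs' ⟨s' i, by simp, ?_⟩
      ext1 j
      by_cases hj : j = i
      · subst hj; simp
      · simp [hj, hcon j hj]
    rw [Finset.prod_eq_zero (Finset.mem_erase.2 ⟨hji, Finset.mem_univ j⟩) (if_neg hj)]
    ring
  · intro b _
    rw [Finset.prod_eq_one]
    · simp
    · intro j hj
      simp [Finset.ne_of_mem_erase hj]

lemma count_update {N : ℕ} (s : Fin N → Fin 2) (i : Fin N) (b : Fin 2) :
    count (Function.update s i b) + (s i : ℕ) = count s + b := by
  simp only [count]
  rw [← Finset.add_sum_erase _ _ (Finset.mem_univ i),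
    ← Finset.add_sum_erase _ (fun j => (s j : ℕ)) (Finset.mem_univ i),
    Function.update_self, Finset.sum_congr rfl fun j hj => by
      rw [Function.update_of_ne (Finset.ne_of_mem_erase hj)]]
  ring

lemma count_le {N : ℕ} (s : Fin N → Fin 2) : count s ≤ N := by
  have := Finset.sum_le_card_nsmul Finset.univ (fun i => (s i : ℕ)) 1 fun i _ => by omega
  simpa [count] using this

/-- For functions of the number of particles in box `1`, the generator is that of the
Ehrenfest birth-and-death chain. -/
lemma generator_count (μ ν : ℝ) {N : ℕ} (f : ℕ → ℝ) (s : Fin N → Fin 2) :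
    ∑ i, ∑ b, particleQ μ ν (s i) b * f (count (Function.update s i b)) =
      (count s : ℝ) * μ * (f (count s - 1) - f (count s)) +
        ((N : ℝ) - count s) * ν * (f (count s + 1) - f (count s)) := by
  have key : ∀ i, ∑ b, particleQ μ ν (s i) b * f (count (Function.update s i b)) =
      ((s i : ℕ) : ℝ) * (μ * (f (count s - 1) - f (count s))) +
        (1 - ((s i : ℕ) : ℝ)) * (ν * (f (count s + 1) - f (count s))) := by
    intro i
    have h0 := count_update s i 0
    have h1 := count_update s i 1
    rw [Fin.sum_univ_two]
    rcases Fin.exists_fin_two.1 ⟨s i, rfl⟩ with h | h <;> rw [h] at h0 h1 ⊢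
    · rw [show count (Function.update s i 0) = count s by simpa using h0,
        show count (Function.update s i 1) = count s + 1 by simpa using h1]
      simp [particleQ]
      ring
    · rw [show count (Function.update s i 0) = count s - 1 by simp at h0; omega,
        show count (Function.update s i 1) = count s by simpa using h1]
      simp [particleQ]
      ring
  rw [Finset.sum_congr rfl fun i _ => key i, Finset.sum_add_distrib, ← Finset.sum_mul,
    ← Finset.sum_mul, Finset.sum_sub_distrib]
  simp only [count]
  push_cast
  simp
  ring

/-- Where the eigenvalue equation holds, the discounted semigroup moves the function by `o(h)`. -/
lemma tendsto_defect {μ ν α : ℝ} (hα : 0 < α) {N : ℕ} (f : ℕ → ℝ) (s : Fin N → Fin 2)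
    (hf : (count s : ℝ) * μ * (f (count s - 1) - f (count s)) +
        ((N : ℝ) - count s) * ν * (f (count s + 1) - f (count s)) = α * f (count s)) :
    Tendsto (fun h => (Real.exp (-α * h) * semigroup μ ν h (fun s => f (count s)) s - f (count s)) /
      (1 - Real.exp (-α * h))) (𝓝[≠] 0) (𝓝 0) := by
  have he : HasDerivAt (fun h : ℝ => Real.exp (-α * h)) (-α) 0 := by
    simpa using ((hasDerivAt_id (0 : ℝ)).const_mul (-α)).exp
  have h1 := (he.mul (hasDerivAt_semigroup μ ν (fun s => f (count s)) s)).tendsto_slope_zero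
  have h2 := (he.const_sub 1).tendsto_slope_zero
  rw [generator_count, hf] at h1
  have h3 := h1.div h2 (by simpa using hα.ne')
  simp only [semigroup_zero, Pi.mul_apply, mul_zero, Real.exp_zero, zero_add, one_mul, sub_self,
    sub_zero, smul_eq_mul, neg_mul, neg_zero, neg_add_cancel, zero_div] at h3
  refine h3.congr' ?_
  filter_upwards [self_mem_nhdsWithin] with h hh
  simp only [Pi.div_apply, neg_mul]
  exact mul_div_mul_left _ _ (inv_ne_zero hh)

/-! ### Discounted stopping of paths and Markov chains in discrete time -/

section Paths

variable {S : Type*}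

open Classical in
/-- The discounted value `β ^ m * F (w m)` of the path `w` at the time `m = min n τ`, where `τ` is
the first time at which `w` is in `H`, written as the sum of its increments. -/
noncomputable def stopped (β : ℝ) (H : Set S) (F : S → ℝ) (w : ℕ → S) (n : ℕ) : ℝ :=
  F (w 0) + ∑ k ∈ Finset.range n,
    if ∀ j ≤ k, w j ∉ H then β ^ k * (β * F (w (k + 1)) - F (w k)) else 0

lemma stopped_of_notMem (β : ℝ) (H : Set S) (F : S → ℝ) (w : ℕ → S) {n : ℕ}
    (h : ∀ j < n, w j ∉ H) : stopped β H F w n = β ^ n * F (w n) := by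
  rw [stopped, Finset.sum_congr rfl (g := fun k => β ^ (k + 1) * F (w (k + 1)) - β ^ k * F (w k)),
    Finset.sum_range_sub (fun k => β ^ k * F (w k))]
  · simp
  · intro k hk
    rw [if_pos fun j hj => h j (by have := Finset.mem_range.1 hk; omega)]
    ring

lemma stopped_of_mem (β : ℝ) (H : Set S) (F : S → ℝ) (w : ℕ → S) {m n : ℕ}
    (h : ∀ j < m, w j ∉ H) (hm : w m ∈ H) (hmn : m ≤ n) :
    stopped β H F w n = β ^ m * F (w m) := by
  rw [← stopped_of_notMem β H F w h]
  obtain ⟨d, rfl⟩ := Nat.exists_eq_add_of_le hmn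
  rw [stopped, stopped, Finset.sum_range_add, Finset.sum_eq_zero (s := Finset.range d), add_zero]
  intro k _
  rw [if_neg]
  push Not
  exact ⟨m, by omega, hm⟩

lemma abs_stopped_le {β : ℝ} (hβ0 : 0 ≤ β) (hβ1 : β ≤ 1) (H : Set S) {F : S → ℝ} {C : ℝ}
    (hF : ∀ s, |F s| ≤ C) (w : ℕ → S) (n : ℕ) : |stopped β H F w n| ≤ C := by
  classical
  have hb : ∀ m, |β ^ m * F (w m)| ≤ C := fun m => by
    rw [abs_mul, abs_of_nonneg (pow_nonneg hβ0 m)]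
    exact (mul_le_of_le_one_left (abs_nonneg _) (pow_le_one₀ hβ0 hβ1)).trans (hF _)
  by_cases h : ∀ j < n, w j ∉ H
  · rw [stopped_of_notMem β H F w h]
    exact hb n
  · push Not at h
    have h' : ∃ j, w j ∈ H := ⟨h.choose, h.choose_spec.2⟩
    obtain ⟨j, hj, hjH⟩ := h
    rw [stopped_of_mem β H F w (fun i hi => Nat.find_min h' hi) (Nat.find_spec h')
      ((Nat.find_min' h' hjH).trans hj.le)]
    exact hb _

end Paths

section Discrete

variable {Ω S T : Type*} [MeasurableSpace Ω] {P : Measure Ω} [IsProbabilityMeasure P]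
  [Fintype S] [MeasurableSpace S] [MeasurableSingletonClass S]
  [Fintype T] [MeasurableSpace T] [MeasurableSingletonClass T]

lemma integrable_comp_of_fintype {V : Ω → T} (hV : Measurable V) (φ : T → ℝ) :
    Integrable (fun ω => φ (V ω)) P := by
  have : IsProbabilityMeasure (P.map V) := Measure.isProbabilityMeasure_map hV.aemeasurable
  exact (Integrable.of_finite (f := φ) (μ := P.map V)).comp_measurable hV

lemma integral_comp_of_fintype {V : Ω → T} (hV : Measurable V) (φ : T → ℝ) :
    ∫ ω, φ (V ω) ∂P = ∑ v, P.real {ω | V ω = v} * φ v := by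
  have : IsProbabilityMeasure (P.map V) := Measure.isProbabilityMeasure_map hV.aemeasurable
  rw [← integral_map (f := φ) hV.aemeasurable (Measurable.of_discrete).aestronglyMeasurable,
    integral_fintype Integrable.of_finite]
  refine Finset.sum_congr rfl fun v _ => ?_
  rw [map_measureReal_apply hV (measurableSet_singleton v)]
  rfl

/-- `X` is a Markov chain in discrete time with transition matrix `p`. -/
def IsChain (P : Measure Ω) (p : S → S → ℝ) (X : ℕ → Ω → S) : Prop :=
  ∀ (k : ℕ) (s : Fin (k + 2) → S), P.real {ω | ∀ i : Fin (k + 2), X i ω = s i} =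
    P.real {ω | ∀ i : Fin (k + 1), X i ω = s i.castSucc} *
      p (s (Fin.last k).castSucc) (s (Fin.last (k + 1)))

/-- The Markov property, for a function `Φ` of the path up to time `k`. -/
lemma IsChain.integral_mul {p : S → S → ℝ} {X : ℕ → Ω → S} (hX : IsChain P p X)
    (hm : ∀ k, Measurable (X k)) (k : ℕ) (Φ : (Fin (k + 1) → S) → ℝ) (g : S → ℝ) :
    ∫ ω, Φ (fun i => X i ω) * g (X (k + 1) ω) ∂P =
      ∫ ω, Φ (fun i => X i ω) * ∑ s', p (X k ω) s' * g s' ∂P := by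
  have h1 := integral_comp_of_fintype (P := P)
    (V := fun ω (i : Fin (k + 2)) => X i ω) (measurable_pi_lambda _ fun i => hm i)
    (fun v => Φ (fun i => v i.castSucc) * g (v (Fin.last (k + 1))))
  have h2 := integral_comp_of_fintype (P := P)
    (V := fun ω (i : Fin (k + 1)) => X i ω) (measurable_pi_lambda _ fun i => hm i)
    (fun v => Φ v * ∑ s', p (v (Fin.last k)) s' * g s')
  simp only [Fin.val_castSucc, Fin.val_last] at h1 h2
  rw [h1, h2, ← (Fin.snocEquiv fun _ => S).sum_comp, Fintype.sum_prod_type, Finset.sum_comm]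
  refine Finset.sum_congr rfl fun v _ => ?_
  rw [Finset.mul_sum, Finset.mul_sum]
  refine Finset.sum_congr rfl fun s' _ => ?_
  have := hX k (Fin.snoc (α := fun _ => S) v s')
  simp only [Fin.snoc_castSucc, Fin.snoc_last] at this
  simp only [Fin.snocEquiv_apply, Fin.snoc_castSucc, Fin.snoc_last, funext_iff]
  rw [this]
  ring

lemma integrable_stopped {X : ℕ → Ω → S} (hm : ∀ k, Measurable (X k)) (β : ℝ) (H : Set S)
    (F : S → ℝ) (n : ℕ) (J : Set S) [DecidablePred (· ∈ J)] :
    Integrable (fun ω => if X 0 ω ∈ J then stopped β H F (fun k => X k ω) n else 0) P := by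
  classical
  have h := integrable_comp_of_fintype (P := P)
    (V := fun ω (i : Fin (n + 1)) => X i ω) (measurable_pi_lambda _ fun i => hm i)
    (fun v => if v 0 ∈ J then stopped β H F (fun k => if h : k < n + 1 then v ⟨k, h⟩ else v 0) n
      else 0)
  refine h.congr (ae_of_all _ fun ω => ?_)
  simp only [Fin.val_zero]
  refine if_congr Iff.rfl ?_ rfl
  simp only [stopped]
  congr 1
  refine Finset.sum_congr rfl fun k hk => ?_
  have hk' := Finset.mem_range.1 hk
  simp only [show k < n + 1 by omega, show k + 1 < n + 1 by omega, dite_true]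
  refine if_congr (forall₂_congr fun j hj => ?_) rfl rfl
  simp only [show j < n + 1 by omega, dite_true]

/-- Optional stopping with error: if `F` is within `ε` of being harmonic for the chain discounted
by `β` off `H`, then stopping at the entrance to `H` changes its mean by `ε / (1 - β)` at most. -/
lemma IsChain.abs_integral_stopped_sub_le {p : S → S → ℝ} {X : ℕ → Ω → S} (hX : IsChain P p X)
    (hm : ∀ k, Measurable (X k)) {β ε : ℝ} (hβ0 : 0 ≤ β) (hβ1 : β < 1) (hε : 0 ≤ ε)
    (H : Set S) (F : S → ℝ) (hF : ∀ s ∉ H, |β * ∑ s', p s s' * F s' - F s| ≤ ε)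
    (J : Set S) [DecidablePred (· ∈ J)] (n : ℕ) :
    |∫ ω, (if X 0 ω ∈ J then stopped β H F (fun k => X k ω) n else 0) ∂P -
      ∫ ω, (if X 0 ω ∈ J then F (X 0 ω) else 0) ∂P| ≤ ε / (1 - β) := by
  classical
  have hstep : ∀ k, |∫ ω, (if X 0 ω ∈ J then stopped β H F (fun k => X k ω) (k + 1) else 0) ∂P -
      ∫ ω, (if X 0 ω ∈ J then stopped β H F (fun k => X k ω) k else 0) ∂P| ≤ ε * β ^ k := by
    intro k
    rw [← integral_sub (integrable_stopped hm β H F (k + 1) J) (integrable_stopped hm β H F k J)]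
    set Φ : (Fin (k + 1) → S) → ℝ := fun v =>
      if v 0 ∈ J ∧ ∀ j, v j ∉ H then β ^ k else 0 with hΦ
    have hall : ∀ ω, (∀ j ≤ k, X j ω ∉ H) ↔ ∀ j : Fin (k + 1), X j ω ∉ H := fun ω =>
      ⟨fun h j => h j (by omega), fun h j hj => h ⟨j, by omega⟩⟩
    have hi : ∀ g : (Fin (k + 2) → S) → ℝ,
        Integrable (fun ω => g fun i : Fin (k + 2) => X i ω) P := fun g =>
      integrable_comp_of_fintype (V := fun ω (i : Fin (k + 2)) => X i ω)
        (measurable_pi_lambda _ fun i => hm i) g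
    have hi1 : Integrable (fun ω => Φ (fun i => X i ω) * F (X (k + 1) ω)) P := by
      simpa using hi fun v => Φ (fun i => v i.castSucc) * F (v (Fin.last (k + 1)))
    have hi2 : Integrable (fun ω => Φ (fun i => X i ω) * F (X k ω)) P := by
      simpa using hi fun v => Φ (fun i => v i.castSucc) * F (v (Fin.last k).castSucc)
    have hi3 : Integrable (fun ω => Φ (fun i => X i ω) * ∑ s', p (X k ω) s' * F s') P := by
      simpa using hi fun v => Φ (fun i => v i.castSucc) *
        ∑ s', p (v (Fin.last k).castSucc) s' * F s'
    have heq : ∫ ω, ((if X 0 ω ∈ J then stopped β H F (fun k => X k ω) (k + 1) else 0) -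
        (if X 0 ω ∈ J then stopped β H F (fun k => X k ω) k else 0)) ∂P =
        ∫ ω, Φ (fun i => X i ω) * (β * ∑ s', p (X k ω) s' * F s' - F (X k ω)) ∂P := by
      calc _ = ∫ ω, (β * (Φ (fun i => X i ω) * F (X (k + 1) ω)) -
              Φ (fun i => X i ω) * F (X k ω)) ∂P := by
            refine integral_congr_ae (ae_of_all _ fun ω => ?_)
            simp only [hΦ, Fin.val_zero, ← hall ω]
            by_cases h0 : X 0 ω ∈ J
            · by_cases h1 : ∀ j ≤ k, X j ω ∉ H
              · simp only [stopped, Finset.sum_range_succ, if_pos h0, if_pos h1,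
                  if_pos (And.intro h0 h1)]
                ring
              · simp only [stopped, Finset.sum_range_succ, if_pos h0, if_neg h1,
                  if_neg (fun h : _ ∧ _ => h1 h.2)]
                ring
            · simp [h0]
        _ = ∫ ω, (β * (Φ (fun i => X i ω) * ∑ s', p (X k ω) s' * F s') -
              Φ (fun i => X i ω) * F (X k ω)) ∂P := by
            rw [integral_sub (hi1.const_mul β) hi2, integral_sub (hi3.const_mul β) hi2,
              integral_const_mul, integral_const_mul, hX.integral_mul hm]
        _ = _ := by
            congr 1
            ext ω
            ring
    rw [heq]
    have := norm_integral_le_of_norm_le_const (μ := P) (C := ε * β ^ k)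
      (f := fun ω => Φ (fun i => X i ω) * (β * ∑ s', p (X k ω) s' * F s' - F (X k ω)))
      (ae_of_all _ fun ω => by
        simp only [hΦ]
        split_ifs with h
        · have hk := hF _ (h.2 (Fin.last k))
          simp only [Fin.val_last] at hk
          rw [norm_mul, Real.norm_eq_abs, Real.norm_eq_abs, abs_of_nonneg (pow_nonneg hβ0 k),
            mul_comm]
          gcongr
        · rw [zero_mul, norm_zero]
          positivity)
    simpa using this
  have hsum : ∀ n, |∫ ω, (if X 0 ω ∈ J then stopped β H F (fun k => X k ω) n else 0) ∂P -
      ∫ ω, (if X 0 ω ∈ J then F (X 0 ω) else 0) ∂P| ≤ ε * ∑ k ∈ Finset.range n, β ^ k := by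
    intro n
    induction n with
    | zero => simp [stopped]
    | succ n ih =>
      rw [Finset.sum_range_succ, mul_add]
      refine (abs_sub_le _ _ _).trans ((add_le_add (hstep n) ih).trans_eq ?_)
      ring
  refine (hsum n).trans ?_
  rw [div_eq_mul_inv]
  refine mul_le_mul_of_nonneg_left ?_ hε
  rw [← tsum_geometric_of_lt_one hβ0 hβ1]
  exact (summable_geometric_of_lt_one hβ0 hβ1).sum_le_tsum _ fun k _ => pow_nonneg hβ0 k

end Discrete

/-! ### Passage to continuous time -/

/-- The finite-dimensional distributions of the configuration are products over the particles. -/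
lemma real_forall_eq_prod {Ω : Type*} [MeasurableSpace Ω] {P : Measure Ω}
    {N : ℕ} {Y : Fin N → ℝ≥0 → Ω → Fin 2} (hi : iIndepFun (fun i ω t => Y i t ω) P)
    {n : ℕ} (t : Fin n → ℝ≥0) (s : Fin n → Fin N → Fin 2) :
    P.real {ω | ∀ j, (fun i => Y i (t j) ω) = s j} = ∏ i, P.real {ω | ∀ j, Y i (t j) ω = s j i} := by
  have h := hi.measure_inter_preimage_eq_mul Finset.univ
    (sets := fun i => {w | ∀ j, w (t j) = s j i}) (fun i _ => by
      rw [Set.ofPred_forall]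
      exact MeasurableSet.iInter fun j => measurable_pi_apply (t j) (measurableSet_singleton _))
  simp only [Measure.real, ← ENNReal.toReal_prod]
  congr 1
  refine Eq.trans ?_ h
  congr 1
  ext ω
  simp only [Set.mem_ofPred_eq, Finset.mem_univ, Set.iInter_true, Set.mem_iInter, Set.mem_preimage,
    funext_iff]
  exact forall_comm

/-- Sampled at the multiples of `h`, the configuration of the particles is a Markov chain. -/
lemma isChain_grid {Ω : Type*} [MeasurableSpace Ω] {P : Measure Ω} {μ ν : ℝ}
    {N : ℕ} {Y : Fin N → ℝ≥0 → Ω → Fin 2}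
    (hY : ∀ i, IsMarkovJumpProcess (particleQ μ ν) P (Y i))
    (hi : iIndepFun (fun i ω t => Y i t ω) P) {h : ℝ≥0} (hh : 0 < h) :
    IsChain P (transition μ ν h) (fun (k : ℕ) ω i => Y i (k * h) ω) := by
  intro k s
  rw [real_forall_eq_prod hi (fun j : Fin (k + 2) => (j : ℝ≥0) * h) s,
    real_forall_eq_prod hi (fun j : Fin (k + 1) => (j : ℝ≥0) * h) (fun j => s j.castSucc),
    transition, ← Finset.prod_mul_distrib]
  refine Finset.prod_congr rfl fun i _ => ?_
  have hm := (hY i).markov k (fun j : Fin (k + 2) => ((j : ℕ) : ℝ≥0) * h) (fun j => s j i)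
    (fun a b hab => by
      have : ((a : ℕ) : ℝ≥0) < ((b : ℕ) : ℝ≥0) := by exact_mod_cast hab
      exact mul_lt_mul_of_pos_right this hh)
  have e : ((((Fin.last (k + 1) : ℕ) : ℝ≥0) * h : ℝ≥0) : ℝ) -
      (((((Fin.last k).castSucc : Fin (k + 2)) : ℕ) : ℝ≥0) * h : ℝ≥0) = h := by
    simp only [Fin.val_last, Fin.val_castSucc]
    push_cast
    ring
  rw [hm, e]
  rfl

section Path

variable {S : Type*}

open Classical in
/-- The discounted value of `F` along the path `w` at the first time at which `w` is in `H`, and `0`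
if there is no such time. -/
noncomputable def entrance (α : ℝ) (H : Set S) (F : S → ℝ) (w : ℝ≥0 → S) : ℝ :=
  if ∃ t, w t ∈ H then
    Real.exp (-α * (sInf {t | w t ∈ H} : ℝ≥0)) * F (w (sInf {t | w t ∈ H})) else 0

/-- A right-continuous path attains its entrance time. -/
lemma sInf_mem_of_rightContinuous {w : ℝ≥0 → S} (hw : ∀ t, ∀ᶠ s in 𝓝[≥] t, w s = w t) {H : Set S}
    (h : ∃ t, w t ∈ H) : w (sInf {t | w t ∈ H}) ∈ H := by
  by_contra hcon
  obtain ⟨u, hu, hsub⟩ := mem_nhdsGE_iff_exists_Ico_subset.1 (hw (sInf {t | w t ∈ H}))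
  obtain ⟨t, ht, htu⟩ := exists_lt_of_csInf_lt (s := {t | w t ∈ H}) h hu
  have : w t = w (sInf {t | w t ∈ H}) := hsub ⟨csInf_le (OrderBot.bddBelow _) ht, htu⟩
  exact hcon (this ▸ ht)

lemma tendsto_mesh : Tendsto (fun n : ℕ => ((n : ℝ≥0) + 1)⁻¹) atTop (𝓝 0) := by
  rw [← NNReal.tendsto_coe]
  simpa using tendsto_one_div_add_atTop_nhds_zero_nat (𝕜 := ℝ)

/-- Along the grids of mesh `1 / (n + 1)` up to time `n + 1`, the discounted value at the entrance
to `H` converges to that of the continuous-time path. -/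
lemma tendsto_stopped [Fintype S] {w : ℝ≥0 → S} (hw : ∀ t, ∀ᶠ s in 𝓝[≥] t, w s = w t) {α : ℝ}
    (hα : 0 < α) (H : Set S) (F : S → ℝ) :
    Tendsto (fun n : ℕ => stopped (Real.exp (-α * (((n : ℝ≥0) + 1)⁻¹ : ℝ≥0))) H F
      (fun k => w (k * ((n : ℝ≥0) + 1)⁻¹)) ((n + 1) ^ 2)) atTop (𝓝 (entrance α H F w)) := by
  have hn : ∀ n : ℕ, ((n : ℝ≥0) + 1) ≠ 0 := fun n => by positivity
  by_cases h : ∃ t, w t ∈ H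
  · rw [entrance, if_pos h]
    have hmem := sInf_mem_of_rightContinuous hw h
    set σ := sInf {t | w t ∈ H} with hσ
    -- `⌈σ * (n + 1)⌉₊` is the index of the first point of the grid which is not before `σ`.
    have hlow : ∀ n : ℕ, σ ≤ (⌈σ * (n + 1)⌉₊ : ℝ≥0) * ((n : ℝ≥0) + 1)⁻¹ := fun n => by
      rw [← div_eq_mul_inv, le_div_iff₀ (by positivity)]
      exact Nat.le_ceil _
    have hlim : Tendsto (fun n : ℕ => (⌈σ * (n + 1)⌉₊ : ℝ≥0) * ((n : ℝ≥0) + 1)⁻¹) atTop (𝓝 σ) := by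
      refine tendsto_of_tendsto_of_tendsto_of_le_of_le tendsto_const_nhds
        (h := fun n : ℕ => σ + ((n : ℝ≥0) + 1)⁻¹) ?_ hlow fun n => ?_
      · simpa using tendsto_const_nhds.add tendsto_mesh
      · have := (Nat.ceil_lt_add_one (zero_le : 0 ≤ σ * ((n : ℝ≥0) + 1))).le
        calc (⌈σ * (n + 1)⌉₊ : ℝ≥0) * ((n : ℝ≥0) + 1)⁻¹
            ≤ (σ * (n + 1) + 1) * ((n : ℝ≥0) + 1)⁻¹ := by gcongr
          _ = σ + ((n : ℝ≥0) + 1)⁻¹ := by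
            rw [add_mul, mul_assoc, mul_inv_cancel₀ (hn n), mul_one, one_mul]
    have hev := (tendsto_nhdsWithin_iff.2 ⟨hlim, Eventually.of_forall hlow⟩).eventually (hw σ)
    have hlim' : Tendsto (fun n : ℕ => Real.exp (-α *
        ((⌈σ * (n + 1)⌉₊ : ℝ≥0) * ((n : ℝ≥0) + 1)⁻¹ : ℝ≥0)) * F (w σ)) atTop
        (𝓝 (Real.exp (-α * σ) * F (w σ))) :=
      ((Real.continuous_exp.tendsto _).comp
        ((NNReal.tendsto_coe.2 hlim).const_mul (-α))).mul_const _
    refine hlim'.congr' ?_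
    filter_upwards [hev, eventually_ge_atTop ⌈σ⌉₊] with n hn1 hn2
    rw [stopped_of_mem (m := ⌈σ * (n + 1)⌉₊), hn1, ← Real.exp_nat_mul]
    · congr 2
      push_cast
      ring
    · intro j hj hjH
      have h1 := Nat.lt_ceil.1 hj
      have h2 : (j : ℝ≥0) * ((n : ℝ≥0) + 1)⁻¹ < σ := by
        rwa [← div_eq_mul_inv, div_lt_iff₀ (by positivity)]
      exact notMem_of_lt_csInf (s := {t | w t ∈ H}) h2 (OrderBot.bddBelow _) hjH
    · rw [hn1]
      exact hmem
    · rw [Nat.ceil_le]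
      push_cast
      rw [sq]
      have := Nat.ceil_le.1 hn2
      gcongr
      exact this.trans (by simp)
  · rw [entrance, if_neg h]
    push Not at h
    have hexp : Tendsto (fun n : ℕ => Real.exp (-(α * ((n : ℝ) + 1))) * ‖F‖) atTop (𝓝 0) := by
      rw [← zero_mul ‖F‖]
      refine Tendsto.mul_const _ (Real.tendsto_exp_neg_atTop_nhds_zero.comp ?_)
      exact Tendsto.const_mul_atTop hα
        (tendsto_atTop_add_const_right _ _ tendsto_natCast_atTop_atTop)
    refine squeeze_zero_norm (fun n => ?_) hexp
    rw [stopped_of_notMem _ _ _ _ fun j _ => h _, norm_mul, ← Real.exp_nat_mul, Real.norm_eq_abs,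
      Real.abs_exp]
    gcongr
    · refine le_of_eq ?_
      push_cast
      field_simp
    · exact norm_le_pi_norm F _

end Path

section Configuration

variable {Ω : Type*} [MeasurableSpace Ω] {P : Measure Ω} {μ ν : ℝ}
    {N : ℕ} {Y : Fin N → ℝ≥0 → Ω → Fin 2}

lemma configuration_rightContinuous (hY : ∀ i, IsMarkovJumpProcess (particleQ μ ν) P (Y i))
    (ω : Ω) (t : ℝ≥0) : ∀ᶠ s in 𝓝[≥] t, (fun i => Y i s ω) = fun i => Y i t ω := by
  have h : ∀ i, ∀ᶠ s in 𝓝[≥] t, Y i s ω = Y i t ω := fun i =>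
    (hY i).rightContinuous ω t |>.eventually (p := fun b => b = Y i t ω)
      ((isOpen_discrete {Y i t ω}).mem_nhds rfl)
  filter_upwards [eventually_all.2 h] with s hs
  exact funext hs

/-- Optional stopping at the entrance to `H`, for initial configurations in `J`. The function `F` has
to be harmonic for the discounted semigroup only to first order at time `0`, and only off `H`. -/
lemma integral_entrance [IsProbabilityMeasure P]
    (hY : ∀ i, IsMarkovJumpProcess (particleQ μ ν) P (Y i))
    (hi : iIndepFun (fun i ω t => Y i t ω) P) {α : ℝ} (hα : 0 < α) (H : Set (Fin N → Fin 2))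
    (F : (Fin N → Fin 2) → ℝ)
    (hF : ∀ s ∉ H, Tendsto (fun h => (Real.exp (-α * h) * semigroup μ ν h F s - F s) /
      (1 - Real.exp (-α * h))) (𝓝[≠] 0) (𝓝 0)) (J : Set (Fin N → Fin 2))
    [DecidablePred (· ∈ J)] :
    Integrable (fun ω =>
      if (fun i => Y i 0 ω) ∈ J then entrance α H F (fun t i => Y i t ω) else 0) P ∧
    ∫ ω, (if (fun i => Y i 0 ω) ∈ J then entrance α H F (fun t i => Y i t ω) else 0) ∂P =
      ∫ ω, (if (fun i => Y i 0 ω) ∈ J then F (fun i => Y i 0 ω) else 0) ∂P := by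
  classical
  set h : ℕ → ℝ≥0 := fun n => ((n : ℝ≥0) + 1)⁻¹ with hh
  have hpos : ∀ n, 0 < h n := fun n => by positivity
  set X : ℕ → ℕ → Ω → (Fin N → Fin 2) := fun n k ω i => Y i (k * h n) ω with hX
  have hX0 : ∀ n ω, X n 0 ω = fun i => Y i 0 ω := fun n ω => by simp [hX]
  have hm : ∀ n k, Measurable (X n k) := fun n k =>
    measurable_pi_lambda _ fun i => (hY i).measurable _
  set β : ℕ → ℝ := fun n => Real.exp (-α * h n) with hβ
  have hβ0 : ∀ n, 0 ≤ β n := fun n => (Real.exp_pos _).le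
  have hβ1 : ∀ n, β n < 1 := fun n => by
    rw [hβ, Real.exp_lt_one_iff]
    have : 0 < α * (h n : ℝ) := mul_pos hα (hpos n)
    linarith
  have hlim : ∀ ω, Tendsto (fun n : ℕ => if X n 0 ω ∈ J then
      stopped (β n) H F (fun k => X n k ω) ((n + 1) ^ 2) else 0) atTop
      (𝓝 (if (fun i => Y i 0 ω) ∈ J then entrance α H F (fun t i => Y i t ω) else 0)) := by
    intro ω
    simp only [hX0]
    split_ifs
    · exact tendsto_stopped (configuration_rightContinuous hY ω) hα H F
    · exact tendsto_const_nhds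
  have hint : ∀ n, Integrable (fun ω => if X n 0 ω ∈ J then
      stopped (β n) H F (fun k => X n k ω) ((n + 1) ^ 2) else 0) P := fun n =>
    integrable_stopped (hm n) (β n) H F _ J
  have hbound : ∀ n ω, ‖if X n 0 ω ∈ J then
      stopped (β n) H F (fun k => X n k ω) ((n + 1) ^ 2) else 0‖ ≤ ‖F‖ := by
    intro n ω
    split_ifs
    · exact abs_stopped_le (hβ0 n) (hβ1 n).le H (norm_le_pi_norm F) _ _
    · simp
  have hmeas := aestronglyMeasurable_of_tendsto_ae (μ := P) atTop
    (fun n => (hint n).aestronglyMeasurable) (ae_of_all _ hlim)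
  refine ⟨(integrable_const ‖F‖).mono' hmeas
    (ae_of_all _ fun ω => le_of_tendsto (hlim ω).norm (Eventually.of_forall (hbound · ω))), ?_⟩
  have hI := tendsto_integral_of_dominated_convergence (μ := P) (fun _ => ‖F‖)
    (fun n => (hint n).aestronglyMeasurable) (integrable_const _)
    (fun n => ae_of_all _ (hbound n)) (ae_of_all _ hlim)
  -- The sum over the finitely many states bounds the error of one step uniformly off `H`.
  set ε : ℕ → ℝ := fun n => ∑ s, if s ∈ H then 0 else |β n * semigroup μ ν (h n) F s - F s|
    with hε
  have hh0 : Tendsto (fun n => (h n : ℝ)) atTop (𝓝[≠] 0) := by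
    refine tendsto_nhdsWithin_iff.2 ⟨NNReal.tendsto_coe.2 tendsto_mesh,
      Eventually.of_forall fun n => ?_⟩
    exact (NNReal.coe_pos.2 (hpos n)).ne'
  have hε0 : Tendsto (fun n => ε n / (1 - β n)) atTop (𝓝 0) := by
    simp only [hε, Finset.sum_div]
    rw [← Finset.sum_const_zero (s := (Finset.univ : Finset (Fin N → Fin 2)))]
    refine tendsto_finsetSum _ fun s _ => ?_
    split_ifs with hs
    · simp
    · have := ((hF s hs).comp hh0).abs
      rw [abs_zero] at this
      refine this.congr fun n => ?_
      simp only [Function.comp_apply]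
      rw [abs_div, abs_of_pos (a := 1 - Real.exp (-α * h n)) (by linarith [hβ1 n])]
  have hle : ∀ n, ‖∫ ω, (if X n 0 ω ∈ J then
      stopped (β n) H F (fun k => X n k ω) ((n + 1) ^ 2) else 0) ∂P -
      ∫ ω, (if X n 0 ω ∈ J then F (X n 0 ω) else 0) ∂P‖ ≤ ε n / (1 - β n) := fun n =>
    (isChain_grid hY hi (hpos n)).abs_integral_stopped_sub_le (hm n) (hβ0 n) (hβ1 n)
    (ε := ε n) (Finset.sum_nonneg fun s _ => by split_ifs <;> positivity)
    H F (fun s hs => by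
      have := Finset.single_le_sum
        (f := fun s => if s ∈ H then 0 else |β n * semigroup μ ν (h n) F s - F s|)
        (fun s _ => by split_ifs <;> positivity) (Finset.mem_univ s)
      rw [if_neg hs] at this
      exact this) J ((n + 1) ^ 2)
  have hdiff := squeeze_zero_norm hle hε0
  have heq := tendsto_nhds_unique hI (by
    have := hdiff.add_const (∫ ω, (if (fun i => Y i 0 ω) ∈ J then F (fun i => Y i 0 ω) else 0) ∂P)
    rw [zero_add] at this
    refine this.congr fun n => ?_
    simp only [Nat.cast_zero, zero_mul, hX, sub_add_cancel])
  exact heq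

end Configuration

/-! ### Hitting times -/

lemma expNeg_coe (α : ℝ) (t : ℝ≥0) : expNeg α t = Real.exp (-α * t) := by
  simp [expNeg]

lemma expNeg_le {α : ℝ} (hα : 0 < α) {t : ℝ≥0} {T : ℝ≥0∞} (h : (t : ℝ≥0∞) ≤ T) :
    expNeg α T ≤ Real.exp (-α * t) := by
  unfold expNeg
  split_ifs with hT
  · positivity
  · have : (t : ℝ) ≤ T.toReal := by simpa using ENNReal.toReal_mono hT h
    rw [Real.exp_le_exp, neg_mul, neg_le_neg_iff]
    gcongr

lemma expNeg_nonneg (α : ℝ) (T : ℝ≥0∞) : 0 ≤ expNeg α T := by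
  unfold expNeg
  split_ifs <;> positivity

lemma measurable_count {Ω : Type*} [MeasurableSpace Ω] {P : Measure Ω} {μ ν : ℝ}
    {N : ℕ} {Y : Fin N → ℝ≥0 → Ω → Fin 2}
    (hY : ∀ i, IsMarkovJumpProcess (particleQ μ ν) P (Y i)) (t : ℝ≥0) :
    Measurable (fun ω => count (fun i => Y i t ω)) :=
  (Measurable.of_discrete (f := count)).comp
    (measurable_pi_lambda _ fun i => (hY i).measurable t)

/-- Started at `z`, a right-continuous process is at `z` at arbitrarily small positive times. -/
lemma laplaceHit_self {Ω : Type*} [MeasurableSpace Ω] {P : Measure Ω} [IsProbabilityMeasure P]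
    {E : ℝ≥0 → Ω → ℕ} (hE : ∀ ω, ∀ᶠ s in 𝓝[≥] (0 : ℝ≥0), E s ω = E 0 ω)
    {z : ℕ} (hm : MeasurableSet {ω | E 0 ω = z}) (hz : P {ω | E 0 ω = z} ≠ 0) (α : ℝ) :
    laplaceHit P E α z z = 1 := by
  have h0 : ∀ ω, E 0 ω = z → hitTime E z ω = 0 := by
    intro ω hω
    obtain ⟨u, hu, hsub⟩ := mem_nhdsGE_iff_exists_Ico_subset.1 (hE ω)
    have hlim : Tendsto (fun t : ℝ≥0 => (t : ℝ≥0∞)) (𝓝[>] 0) (𝓝 0) :=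
      (ENNReal.continuous_coe.tendsto' 0 0 (by simp)).mono_left nhdsWithin_le_nhds
    refine le_antisymm (ge_of_tendsto hlim ?_) bot_le
    filter_upwards [Ioo_mem_nhdsGT hu] with t ht
    have : E t ω = E 0 ω := hsub ⟨ht.1.le, ht.2⟩
    exact iInf₂_le t ⟨ht.1, this.trans hω⟩
  have := cond_isProbabilityMeasure (μ := P) hz
  rw [laplaceHit, integral_congr_ae (g := fun _ => (1 : ℝ))]
  · simp
  · filter_upwards [ae_cond_mem hm] with ω hω
    rw [h0 ω hω]
    simp [expNeg]

section Path

variable {Ω : Type*} {N : ℕ} {E : ℝ≥0 → Ω → ℕ} {ω : Ω} {w : ℝ≥0 → Fin N → Fin 2}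

/-- Counting only the entrances to `H` at `x` bounds the transform of the hitting time of `x` from
below. The path starts outside `H`, so its entrance time is positive, as `hitTime` requires. -/
lemma entrance_le_expNeg_hitTime (hw : ∀ t, ∀ᶠ s in 𝓝[≥] t, w s = w t)
    (hE : ∀ t, E t ω = count (w t)) {α : ℝ} {H : Set ℕ} (h0 : count (w 0) ∉ H)
    {x : ℕ} (hx : x ∈ H) {f : ℕ → ℝ} (hfx : 0 ≤ f x) (hf : ∀ k ∈ H, k ≠ x → f k = 0) :
    entrance α {s | count s ∈ H} (fun s => f (count s)) w ≤
      f x * expNeg α (hitTime E x ω) := by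
  unfold entrance
  beta_reduce
  split_ifs with h
  · have hmem : count (w _) ∈ H := sInf_mem_of_rightContinuous hw h
    set σ := sInf {t | w t ∈ {s : Fin N → Fin 2 | count s ∈ H}} with hσ
    by_cases hc : count (w σ) = x
    · have hσ0 : 0 < σ := by
        rw [pos_iff_ne_zero]
        intro h'
        rw [h'] at hmem
        exact h0 hmem
      have hhit : hitTime E x ω = σ := by
        refine le_antisymm (iInf₂_le σ ⟨hσ0, (hE σ).trans hc⟩) (le_iInf₂ fun t ht => ?_)
        refine ENNReal.coe_le_coe.2 (csInf_le (OrderBot.bddBelow _) ?_)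
        change count (w t) ∈ H
        rw [← hE, ht.2]
        exact hx
      rw [hhit, expNeg_coe, hc, mul_comm]
    · rw [hf _ hmem hc, mul_zero]
      exact mul_nonneg hfx (expNeg_nonneg _ _)
  · exact mul_nonneg hfx (expNeg_nonneg _ _)

/-- Counting all entrances to `H` as if at `x` gives an upper bound, since `x` is hit no earlier than
`H` is entered. -/
lemma expNeg_hitTime_le_entrance (hw : ∀ t, ∀ᶠ s in 𝓝[≥] t, w s = w t)
    (hE : ∀ t, E t ω = count (w t)) {α : ℝ} (hα : 0 < α) {H : Set ℕ}
    {x : ℕ} (hx : x ∈ H) {f : ℕ → ℝ} (hfx : 0 ≤ f x) (hf : ∀ k ∈ H, f k = f x) :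
    f x * expNeg α (hitTime E x ω) ≤
      entrance α {s | count s ∈ H} (fun s => f (count s)) w := by
  have hH : ∀ t, E t ω = x → w t ∈ {s : Fin N → Fin 2 | count s ∈ H} := fun t ht => by
    change count (w t) ∈ H
    rw [← hE, ht]
    exact hx
  unfold entrance
  beta_reduce
  split_ifs with h
  · have hmem : count (w _) ∈ H := sInf_mem_of_rightContinuous hw h
    rw [hf _ hmem, mul_comm]
    refine mul_le_mul_of_nonneg_right (expNeg_le hα (le_iInf₂ fun t ht => ?_)) hfx
    exact ENNReal.coe_le_coe.2 (csInf_le (OrderBot.bddBelow _) (hH t ht.2))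
  · have : hitTime E x ω = ∞ := by
      simp only [hitTime, iInf_eq_top, ENNReal.coe_ne_top]
      exact fun t ht => h ⟨t, hH t ht.2⟩
    simp [this, expNeg]

end Path

/-- If `f` solves the eigenvalue equation off `H`, and `x` is the only state of `H` which can be
reached in one jump from outside `H`, then the Laplace transform of the hitting time of `x` from
outside `H` is a quotient of values of `f`. -/
theorem laplaceHit_eq_div {Ω : Type*} [MeasurableSpace Ω] {P : Measure Ω} [IsProbabilityMeasure P]
    {μ ν : ℝ} {N : ℕ} {E : ℝ≥0 → Ω → ℕ} (hE : IsEhrenfestProcess μ ν N P E)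
    {α : ℝ} (hα : 0 < α) {H : Set ℕ} {x z : ℕ} (hx : x ∈ H) (hz : z ∉ H) {f : ℕ → ℝ}
    (hfx : 0 < f x)
    (hf : ∀ k ≤ N, k ∉ H → (k : ℝ) * μ * (f (k - 1) - f k) +
      ((N : ℝ) - k) * ν * (f (k + 1) - f k) = α * f k)
    (hdown : ∀ k ≤ N, k ∉ H → k ≠ 0 → k - 1 ∈ H → k - 1 = x)
    (hup : ∀ k < N, k ∉ H → k + 1 ∈ H → k + 1 = x)
    (hP : P {ω | E 0 ω = z} ≠ 0) :
    laplaceHit P E α z x = f z / f x := by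
  classical
  obtain ⟨Y, hY, hi, hsum⟩ := hE
  have hcount : ∀ t ω, E t ω = count (fun i => Y i t ω) := hsum
  have hm : MeasurableSet {ω | E 0 ω = z} := by
    simp only [hcount]
    exact measurable_count hY 0 (measurableSet_singleton z)
  -- The values of `f` on `H` other than at `x` do not enter the equation off `H`.
  set g : ℝ → ℕ → ℝ := fun c k => if k ∈ H ∧ k ≠ x then c else f k with hg
  have hgx : ∀ c, g c x = f x := fun c => by simp [hg]
  have hgH : ∀ c, ∀ k ∈ H, k ≠ x → g c k = c := fun c k h1 h2 => by simp [hg, h1, h2]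
  have hgf : ∀ c k, (k ∈ H → k = x) → g c k = f k := fun c k h => by
    simp only [hg]
    exact if_neg fun h' => h'.2 (h h'.1)
  have hgen : ∀ c, ∀ s : Fin N → Fin 2, count s ∉ H →
      (count s : ℝ) * μ * (g c (count s - 1) - g c (count s)) +
        ((N : ℝ) - count s) * ν * (g c (count s + 1) - g c (count s)) = α * g c (count s) := by
    intro c s hs
    have hN := count_le s
    rw [hgf c (count s) (fun h => absurd h hs), ← hf _ hN hs]
    congr 1
    · rcases eq_or_ne (count s) 0 with h | h
      · simp [h]
      · rw [hgf c _ (hdown _ hN hs h)]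
    · rcases hN.eq_or_lt with h | h
      · simp [h]
      · rw [hgf c _ (hup _ h hs)]
  have hmean := fun c => integral_entrance hY hi hα {s | count s ∈ H} (fun s => g c (count s))
    (fun s hs => tendsto_defect hα (g c) s (hgen c s hs)) {s | count s = z}
  have hval : ∀ c, ∫ ω, (if (fun i => Y i 0 ω) ∈ {s : Fin N → Fin 2 | count s = z} then
      g c (count fun i => Y i 0 ω) else 0) ∂P = P.real {ω | E 0 ω = z} * f z := by
    intro c
    rw [← smul_eq_mul, ← integral_indicator_const (f z) hm]
    congr 1
    ext ω
    simp only [Set.indicator, Set.mem_ofPred_eq, hcount]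
    split_ifs with h
    · rw [h, hgf c z (fun h => absurd h hz)]
    · rfl
  -- The process may enter `H` elsewhere than at `x` only with probability `0`, since the value of
  -- `f` there does not influence the mean. The two choices `0` and `f x` enclose the
  -- transform of the hitting time.
  obtain ⟨hi0, hI0⟩ := hmean 0
  obtain ⟨hi1, hI1⟩ := hmean (f x)
  rw [hval] at hI0 hI1
  set L : ℝ → Ω → ℝ := fun c ω => if (fun i => Y i 0 ω) ∈ {s : Fin N → Fin 2 | count s = z} then
    entrance α {s | count s ∈ H} (fun s => g c (count s)) (fun t i => Y i t ω) else 0 with hL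
  have hlow : ∀ ω, L 0 ω ≤
      {ω | E 0 ω = z}.indicator (fun ω => f x * expNeg α (hitTime E x ω)) ω := by
    intro ω
    simp only [hL, Set.indicator, Set.mem_ofPred_eq, ← hcount]
    split_ifs with h
    · have := entrance_le_expNeg_hitTime (α := α) (configuration_rightContinuous hY ω) (hcount · ω)
        (by rw [← hcount, h]; exact hz) hx (f := g 0) (by rw [hgx]; exact hfx.le) (hgH 0)
      rwa [hgx] at this
    · exact le_rfl
  have hupp : ∀ ω,
      {ω | E 0 ω = z}.indicator (fun ω => f x * expNeg α (hitTime E x ω)) ω ≤ L (f x) ω := by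
    intro ω
    simp only [hL, Set.indicator, Set.mem_ofPred_eq, ← hcount]
    split_ifs with h
    · have := expNeg_hitTime_le_entrance (configuration_rightContinuous hY ω) (hcount · ω)
        hα hx (f := g (f x)) (by rw [hgx]; exact hfx.le) (fun k hk => by
          rcases eq_or_ne k x with rfl | h
          · rfl
          · rw [hgH _ k hk h, hgx])
      rwa [hgx] at this
    · exact le_rfl
  have hae : L (f x) - L 0 =ᵐ[P] 0 := by
    refine (integral_eq_zero_iff_of_nonneg (fun ω => sub_nonneg.2 ((hlow ω).trans (hupp ω)))
      (hi1.sub hi0)).1 ?_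
    refine (integral_sub hi1 hi0).trans ?_
    rw [hI1, hI0, sub_self]
  have hint : ∫ ω, {ω | E 0 ω = z}.indicator (fun ω => f x * expNeg α (hitTime E x ω)) ω ∂P =
      P.real {ω | E 0 ω = z} * f z := by
    rw [← hI0]
    refine integral_congr_ae ?_
    filter_upwards [hae] with ω hω
    refine le_antisymm ((hupp ω).trans_eq ?_) (hlow ω)
    exact sub_eq_zero.1 hω
  rw [integral_indicator hm, integral_const_mul] at hint
  have hP' : P.real {ω | E 0 ω = z} ≠ 0 := by
    rwa [measureReal_def, ENNReal.toReal_ne_zero, and_iff_left (measure_ne_top _ _)]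
  rw [laplaceHit, ProbabilityTheory.cond, integral_smul_measure, ENNReal.toReal_inv,
    ← measureReal_def, smul_eq_mul, eq_div_iff hfx.ne', mul_assoc, mul_comm _ (f x), hint,
    inv_mul_cancel_left₀ hP']

end Ehrenfest

theorem mainTheorem1 {Ω : Type*} [MeasurableSpace Ω] (P : Measure Ω) [IsProbabilityMeasure P]
    (μ ν : ℝ) (hμ : 0 < μ) (hν : 0 < ν) (hμν : ν + μ = 1)
    (N : ℕ) (E : ℝ≥0 → Ω → ℕ) (hE : Ehrenfest.IsEhrenfestProcess μ ν N P E)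
    (α : ℝ) (hα : 0 < α) (x y : ℕ) (hxy : x ≤ y) (hyN : y ≤ N) :
    (P {ω | E 0 ω = y} ≠ 0 →
      Ehrenfest.laplaceHit P E α y x = Ehrenfest.B μ ν N α y / Ehrenfest.B μ ν N α x) ∧
    (P {ω | E 0 ω = x} ≠ 0 →
      Ehrenfest.laplaceHit P E α x y = Ehrenfest.D μ ν N α x / Ehrenfest.D μ ν N α y) := by
  have hB := fun k => Ehrenfest.B_pos hμ hν N hα k
  have hD : ∀ k ≤ N, 0 < Ehrenfest.D μ ν N α k := fun k hk => by
    rw [Ehrenfest.D_eq_B μ ν α hk]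
    exact Ehrenfest.B_pos hν hμ N hα _
  rcases hxy.eq_or_lt with rfl | hlt
  · have hself : P {ω | E 0 ω = x} ≠ 0 → Ehrenfest.laplaceHit P E α x x = 1 := by
      obtain ⟨Y, hY, -, hsum⟩ := hE
      refine fun h => Ehrenfest.laplaceHit_self (fun ω => ?_) ?_ h α
      · filter_upwards [Ehrenfest.configuration_rightContinuous hY ω 0] with s hs
        rw [hsum, hsum]
        exact Finset.sum_congr rfl fun i _ => congrArg _ (congrFun hs i)
      · simp only [hsum]
        exact Ehrenfest.measurable_count hY 0 (measurableSet_singleton x)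
    rw [div_self (hB x).ne', div_self (hD x hyN).ne']
    exact ⟨hself, hself⟩
  · constructor
    · refine Ehrenfest.laplaceHit_eq_div hE hα (H := {k | k ≤ x}) (le_refl x) hlt.not_ge (hB x)
        (fun k hk hkx => Ehrenfest.B_generator hμ hμν N hα ?_ hk) ?_ ?_ <;>
      · simp only [Set.mem_ofPred_eq] at *
        omega
    · refine Ehrenfest.laplaceHit_eq_div hE hα (H := {k | y ≤ k}) (le_refl y) hlt.not_ge
        (hD y hyN) (fun k hk hkx => Ehrenfest.D_generator hν hμν N hα ?_) ?_ ?_ <;>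
      · simp only [Set.mem_ofPred_eq] at *
        omega
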